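/- Let $G$ be a (Hausdorff) locally compact group, let $\mathcal B=(B_t)_{t\in G}$ be a Fell bundle over $G$, and let $\mathcal A=(A_t)_{t\in G}$ be a Fell subbundle of $\mathcal B$ (closed subspaces $A_t\subseteq B_t$ with $A_sA_t\subseteq A_{st}$ and $A_t^*=A_{t^{-1}}$, which form a Fell bundle over $G$ with the structure and topology inherited from $\mathcal B$). Let $E:\mathcal B\to\mathcal A$ be a conditional expectation, i.e. a continuous idempotent map whose restriction to each $B_t$ is a linear map $B_t\to A_t$, with $E(\mathcal B)=\mathcal A$, $\|E|_{B_e}\|=1$ and $E(aba')=aE(b)a'$ for all $a,a'\in\mathcal A$, $b\in\mathcal B$. For $\mathbb t=(t_1,\dots,t_n)\in G^n$ let $\mathbb M_{\mathbb t}(\mathcal B)$ be the $*$-algebra (with the usual matrix operations) of all $n\times n$ matrices $M=(M_{ij})$ with $M_{ij}\in B_{t_it_j^{-1}}$ for all $i,j$; it is a C*-algebra, and $\mathbb M_{\mathbb t}(\mathcal A)$, the set of those $M$ with $M_{ij}\in A_{t_it_j^{-1}}$ for all $i,j$, is a C*-subalgebra of it. An element of a C*-algebra is positive if it is of the form $c^*c$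 with $c$ in the algebra. Let $E_{\mathbb t}:\mathbb M_{\mathbb t}(\mathcal B)\to\mathbb M_{\mathbb t}(\mathcal A)$ be the linear map $E_{\mathbb t}(M)=(E(M_{ij}))_{ij}$. Then: 1. $E_{\mathbb t}$ is idempotent: $E_{\mathbb t}(E_{\mathbb t}(M))=E_{\mathbb t}(M)$ for all $M\in\mathbb M_{\mathbb t}(\mathcal B)$; 2. $E_{\mathbb t}$ is positive: if $M$ is a positive element of $\mathbb M_{\mathbb t}(\mathcal B)$, then $E_{\mathbb t}(M)$ is a positive element of $\mathbb M_{\mathbb t}(\mathcal A)$; 3. $E_{\mathbb t}$ is an $\mathbb M_{\mathbb t}(\mathcal A)$-bimodule map: $E_{\mathbb t}(NM)=N\,E_{\mathbb t}(M)$ and $E_{\mathbb t}(MN)=E_{\mathbb t}(M)\,N$ for all $M\in\mathbb M_{\mathbb t}(\mathcal B)$ and $N\in\mathbb M_{\mathbb t}(\mathcal A)$; 4. the image of $E_{\mathbb t}$ is $\mathbb M_{\mathbb t}(\mathcal A)$. Moreover, $M\in\mathbb M_{\mathbb t}(\mathcal B)$ is positive in $\mathbb M_{\mathbb t}(\mathcal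 B)$ if and only if for every $k=1,\dots,n$ and every $y=(y_1,\dots,y_n)$ with $y_i\in B_{t_it_k^{-1}}$ the element $\sum_{i,j=1}^n y_i^*M_{ij}y_j$ is positive in the C*-algebra $B_e$. -/

import Mathlib

universe u v

/-- The fibre `p⁻¹(x)` of a map `p : T → X`, as a type of its own. It is not a `Subtype`, so that
the only topology it carries is the one of the norm it is given below. -/
@[ext]
structure Fib {T : Type v} {X : Type u} (p : T → X) (x : X) where
  val : T
  mem : p val = x

/-- Banach bundles over a topological space `X` (in the sense of Fell and Doran, with continuous
norm). -/
structure BanachBundle (X : Type u) [TopologicalSpace X] where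
  /-- the total space -/
  Total : Type v
  [topTotal : TopologicalSpace Total]
  [t2Total : T2Space Total]
  /-- the bundle projection -/
  proj : Total → X
  continuous_proj : Continuous proj
  isOpenMap_proj : IsOpenMap proj
  surjective_proj : Function.Surjective proj
  /-- every fibre is a complex Banach space -/
  [fibNormed : ∀ x, NormedAddCommGroup (Fib proj x)]
  [fibSpace : ∀ x, NormedSpace ℂ (Fib proj x)]
  [fibComplete : ∀ x, CompleteSpace (Fib proj x)]
  continuous_norm : Continuous fun b : Total => ‖(⟨b, rfl⟩ : Fib proj (proj b))‖
  continuous_add : Continuous fun q : {q : Total × Total // proj q.1 = proj q.2} =>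
    ((⟨q.1.1, q.2⟩ : Fib proj (proj q.1.2)) + ⟨q.1.2, rfl⟩).val
  continuous_smul : ∀ c : ℂ, Continuous fun b : Total => (c • (⟨b, rfl⟩ : Fib proj (proj b))).val
  /-- if `‖b_i‖ → 0` and `proj b_i → x`, then `b_i → 0_x` -/
  tendsto_zero : ∀ x : X,
    Filter.comap (fun b : Total => ‖(⟨b, rfl⟩ : Fib proj (proj b))‖) (nhds 0) ⊓
      Filter.comap proj (nhds x) ≤ nhds (0 : Fib proj x).val

attribute [instance] BanachBundle.topTotal BanachBundle.t2Total BanachBundle.fibNormed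
  BanachBundle.fibSpace BanachBundle.fibComplete

namespace BanachBundle

variable {X : Type u} [TopologicalSpace X]

/-- The fibre `B_x`. -/
abbrev Fiber (B : BanachBundle.{u, v} X) (x : X) : Type v := Fib B.proj x

/-- The norm of a point of the total space, computed in its fibre. -/
noncomputable def tnorm (B : BanachBundle.{u, v} X) (b : B.Total) : ℝ :=
  ‖(⟨b, rfl⟩ : B.Fiber (B.proj b))‖

end BanachBundle

/-- Fell bundles (that is, C*-algebraic bundles) over a topological group `G`: Banach bundles with
an associative product `B_r × B_s → B_{rs}` and an involution `B_r → B_{r⁻¹}`. -/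
structure FellBundle (G : Type u) [Group G] [TopologicalSpace G] extends
    BanachBundle.{u, v} G where
  /-- associative product of the total space -/
  [semigroupTotal : Semigroup Total]
  /-- involution of the total space, with `(bc)* = c* b*` and `b** = b` -/
  [starTotal : StarMul Total]
  proj_mul : ∀ b c : Total, proj (b * c) = proj b * proj c
  proj_star : ∀ b : Total, proj (star b) = (proj b)⁻¹
  mul_add : ∀ {r s : G} (b : Fib proj r) (c d : Fib proj s),
    b.val * (c + d).val =
      ((⟨b.val * c.val, by rw [proj_mul, b.mem, c.mem]⟩ : Fib proj (r * s)) +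
        ⟨b.val * d.val, by rw [proj_mul, b.mem, d.mem]⟩).val
  add_mul : ∀ {r s : G} (b c : Fib proj r) (d : Fib proj s),
    (b + c).val * d.val =
      ((⟨b.val * d.val, by rw [proj_mul, b.mem, d.mem]⟩ : Fib proj (r * s)) +
        ⟨c.val * d.val, by rw [proj_mul, c.mem, d.mem]⟩).val
  smul_mul : ∀ {r s : G} (z : ℂ) (b : Fib proj r) (c : Fib proj s),
    (z • b).val * c.val =
      (z • (⟨b.val * c.val, by rw [proj_mul, b.mem, c.mem]⟩ : Fib proj (r * s))).val
  mul_smul : ∀ {r s : G} (z : ℂ) (b : Fib proj r) (c : Fib proj s),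
    b.val * (z • c).val =
      (z • (⟨b.val * c.val, by rw [proj_mul, b.mem, c.mem]⟩ : Fib proj (r * s))).val
  star_add : ∀ {r : G} (b c : Fib proj r),
    star (b + c).val =
      ((⟨star b.val, by rw [proj_star, b.mem]⟩ : Fib proj r⁻¹) +
        ⟨star c.val, by rw [proj_star, c.mem]⟩).val
  star_smul : ∀ {r : G} (z : ℂ) (b : Fib proj r),
    star (z • b).val =
      (star z • (⟨star b.val, by rw [proj_star, b.mem]⟩ : Fib proj r⁻¹)).val
  continuous_mul : Continuous fun q : Total × Total => q.1 * q.2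
  continuous_star : Continuous fun b : Total => star b
  norm_mul_le : ∀ b c : Total,
    toBanachBundle.tnorm (b * c) ≤ toBanachBundle.tnorm b * toBanachBundle.tnorm c
  norm_star : ∀ b : Total, toBanachBundle.tnorm (star b) = toBanachBundle.tnorm b
  /-- the C*-identity -/
  norm_star_mul_self : ∀ b : Total,
    toBanachBundle.tnorm (star b * b) = toBanachBundle.tnorm b ^ 2
  /-- `b* b` is a positive element of the C*-algebra `B_e`, that is, `b* b = c* c` for some
  `c ∈ B_e` -/
  star_mul_self_pos : ∀ b : Total, ∃ c : Total, proj c = 1 ∧ star b * b = star c * c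

attribute [instance] FellBundle.semigroupTotal FellBundle.starTotal

/-- Positive elements of a C*-algebra: those of the form `c* c`. -/
def IsPos {R : Type*} [Mul R] [Star R] (a : R) : Prop := ∃ c : R, a = star c * c

namespace FellBundle

variable {G : Type u} [Group G] [TopologicalSpace G]

section Fibers

variable (B : FellBundle.{u, v} G)

/-- The product `B_r × B_s → B_u`, where `u = rs`. -/
def fmul {r s u : G} (h : r * s = u) (b : B.Fiber r) (c : B.Fiber s) : B.Fiber u :=
  ⟨b.val * c.val, by rw [B.proj_mul, b.mem, c.mem, h]⟩

/-- The involution `B_r → B_s`, where `s = r⁻¹`. -/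
def fstar {r s : G} (h : r⁻¹ = s) (b : B.Fiber r) : B.Fiber s :=
  ⟨star b.val, by rw [B.proj_star, b.mem, h]⟩

variable {B}

theorem fmul_add {r s u : G} (h : r * s = u) (b : B.Fiber r) (c d : B.Fiber s) :
    B.fmul h b (c + d) = B.fmul h b c + B.fmul h b d := by
  subst h; exact Fib.ext (B.mul_add b c d)

theorem add_fmul {r s u : G} (h : r * s = u) (b c : B.Fiber r) (d : B.Fiber s) :
    B.fmul h (b + c) d = B.fmul h b d + B.fmul h c d := by
  subst h; exact Fib.ext (B.add_mul b c d)

theorem smul_fmul {r s u : G} (h : r * s = u) (z : ℂ) (b : B.Fiber r) (c : B.Fiber s) :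
    B.fmul h (z • b) c = z • B.fmul h b c := by
  subst h; exact Fib.ext (B.smul_mul z b c)

theorem fmul_smul {r s u : G} (h : r * s = u) (z : ℂ) (b : B.Fiber r) (c : B.Fiber s) :
    B.fmul h b (z • c) = z • B.fmul h b c := by
  subst h; exact Fib.ext (B.mul_smul z b c)

theorem fstar_add {r s : G} (h : r⁻¹ = s) (b c : B.Fiber r) :
    B.fstar h (b + c) = B.fstar h b + B.fstar h c := by
  subst h; exact Fib.ext (B.star_add b c)

theorem fstar_smul {r s : G} (h : r⁻¹ = s) (z : ℂ) (b : B.Fiber r) :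
    B.fstar h (z • b) = star z • B.fstar h b := by
  subst h; exact Fib.ext (B.star_smul z b)

theorem fmul_sum {r s u : G} (h : r * s = u) {ι : Type*} (S : Finset ι) (b : B.Fiber r)
    (c : ι → B.Fiber s) : B.fmul h b (∑ i ∈ S, c i) = ∑ i ∈ S, B.fmul h b (c i) :=
  map_sum (AddMonoidHom.mk' (B.fmul h b) (fmul_add h b)) c S

theorem sum_fmul {r s u : G} (h : r * s = u) {ι : Type*} (S : Finset ι) (b : ι → B.Fiber r)
    (c : B.Fiber s) : B.fmul h (∑ i ∈ S, b i) c = ∑ i ∈ S, B.fmul h (b i) c :=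
  map_sum (AddMonoidHom.mk' (fun b => B.fmul h b c) (fun b b' => add_fmul h b b' c)) b S

theorem fstar_sum {r s : G} (h : r⁻¹ = s) {ι : Type*} (S : Finset ι) (b : ι → B.Fiber r) :
    B.fstar h (∑ i ∈ S, b i) = ∑ i ∈ S, B.fstar h (b i) :=
  map_sum (AddMonoidHom.mk' (B.fstar h) (fstar_add h)) b S

variable (B)

/-- The product of the unit fibre `B_e`. -/
instance unitFiberMul : Mul (B.Fiber (1 : G)) := ⟨fun b c => B.fmul (mul_one 1) b c⟩

/-- The involution of the unit fibre `B_e`. -/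
instance unitFiberStar : Star (B.Fiber (1 : G)) := ⟨fun b => B.fstar inv_one b⟩

end Fibers

section Matrices

variable (B : FellBundle.{u, v} G) {n : ℕ} (t : Fin n → G)

/-- `𝕄_t(B)`: the `n × n` matrices `M` with `M_ij ∈ B_{t_i t_j⁻¹}`. -/
def MatAlg : Type v := ∀ i j : Fin n, B.Fiber (t i * (t j)⁻¹)

/-- `Y_t(B) = B_{t_1} ⊕ ⋯ ⊕ B_{t_n}`. -/
abbrev Y : Type v := ∀ i : Fin n, B.Fiber (t i)

noncomputable instance : AddCommGroup (B.MatAlg t) :=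
  inferInstanceAs (AddCommGroup (∀ i j : Fin n, B.Fiber (t i * (t j)⁻¹)))

noncomputable instance : Module ℂ (B.MatAlg t) :=
  inferInstanceAs (Module ℂ (∀ i j : Fin n, B.Fiber (t i * (t j)⁻¹)))

/-- Matrix product: `(MN)_ij = ∑ k, M_ik N_kj`. -/
noncomputable instance : Mul (B.MatAlg t) :=
  ⟨fun M N i j => ∑ k, B.fmul (by group) (M i k) (N k j)⟩

/-- Matrix involution: `(M*)_ij = (M_ji)*`. -/
instance : Star (B.MatAlg t) := ⟨fun M i j => B.fstar (by group) (M j i)⟩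

variable {B t}

@[ext]
theorem MatAlg.ext {M N : B.MatAlg t} (h : ∀ i j, M i j = N i j) : M = N :=
  funext fun i => funext fun j => h i j

theorem MatAlg.add_apply (M N : B.MatAlg t) (i j : Fin n) : (M + N) i j = M i j + N i j := rfl

theorem MatAlg.zero_apply (i j : Fin n) : (0 : B.MatAlg t) i j = 0 := rfl

theorem MatAlg.smul_apply (z : ℂ) (M : B.MatAlg t) (i j : Fin n) :
    (z • M) i j = z • M i j := rfl

theorem MatAlg.mul_apply (M N : B.MatAlg t) (i j : Fin n) :
    (M * N) i j = ∑ k, B.fmul (by group) (M i k) (N k j) := rfl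

theorem MatAlg.star_apply (M : B.MatAlg t) (i j : Fin n) :
    (star M) i j = B.fstar (by group) (M j i) := rfl

theorem MatAlg.left_distrib (L M N : B.MatAlg t) : L * (M + N) = L * M + L * N := by
  refine MatAlg.ext fun i j => ?_
  simp only [MatAlg.mul_apply, MatAlg.add_apply, fmul_add, Finset.sum_add_distrib]

theorem MatAlg.right_distrib (L M N : B.MatAlg t) : (L + M) * N = L * N + M * N := by
  refine MatAlg.ext fun i j => ?_
  simp only [MatAlg.mul_apply, MatAlg.add_apply, add_fmul, Finset.sum_add_distrib]

theorem MatAlg.assoc (L M N : B.MatAlg t) : L * M * N = L * (M * N) := by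
  refine MatAlg.ext fun i j => ?_
  simp only [MatAlg.mul_apply, fmul_sum, sum_fmul]
  rw [Finset.sum_comm]
  refine Finset.sum_congr rfl fun k _ => Finset.sum_congr rfl fun l _ => ?_
  exact Fib.ext (_root_.mul_assoc _ _ _)

noncomputable instance : NonUnitalRing (B.MatAlg t) where
  left_distrib := MatAlg.left_distrib
  right_distrib := MatAlg.right_distrib
  zero_mul M := by
    have h := MatAlg.right_distrib 0 0 M
    rw [add_zero] at h
    exact left_eq_add.mp h
  mul_zero M := by
    have h := MatAlg.left_distrib M 0 0
    rw [add_zero] at h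
    exact left_eq_add.mp h
  mul_assoc := MatAlg.assoc

instance : IsScalarTower ℂ (B.MatAlg t) (B.MatAlg t) where
  smul_assoc z M N := by
    refine MatAlg.ext fun i j => ?_
    simp only [smul_eq_mul, MatAlg.mul_apply, MatAlg.smul_apply, smul_fmul, Finset.smul_sum]

instance : SMulCommClass ℂ (B.MatAlg t) (B.MatAlg t) where
  smul_comm z M N := by
    refine MatAlg.ext fun i j => ?_
    simp only [smul_eq_mul, MatAlg.mul_apply, MatAlg.smul_apply, fmul_smul, Finset.smul_sum]

instance : StarRing (B.MatAlg t) where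
  star_involutive M := by
    refine MatAlg.ext fun i j => ?_
    exact Fib.ext (star_star _)
  star_mul M N := by
    refine MatAlg.ext fun i j => ?_
    simp only [MatAlg.star_apply, MatAlg.mul_apply, fstar_sum]
    exact Finset.sum_congr rfl fun k _ => Fib.ext (StarMul.star_mul _ _)
  star_add M N := by
    refine MatAlg.ext fun i j => ?_
    simp only [MatAlg.star_apply, MatAlg.add_apply, fstar_add]

instance : StarModule ℂ (B.MatAlg t) where
  star_smul z M := by
    refine MatAlg.ext fun i j => ?_
    simp only [MatAlg.star_apply, MatAlg.smul_apply, fstar_smul]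

variable (B t)

/-- For `M ∈ 𝕄_t(B)` and `y ∈ Y_{tr}(B)`, where `tr = (t_1 r, …, t_n r)`, the element
`∑ i j, y_i* M_ij y_j` of `B_e`. -/
noncomputable def quadForm (r : G) (M : B.MatAlg t) (y : B.Y fun i => t i * r) :
    B.Fiber (1 : G) :=
  ∑ i, ∑ j, B.fmul (r := (t i * r)⁻¹) (s := t i * r) (by group) (B.fstar rfl (y i))
    (B.fmul (r := t i * (t j)⁻¹) (s := t j * r) (by group) (M i j) (y j))

end Matrices

end FellBundle

/-- Fell subbundles of `B`: closed linear subspaces `A_t` of the fibres `B_t`, stable under the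
product and the involution, such that `A = ⋃ A_t` with the relative topology is a bundle over `G`,
i.e. the restriction of the projection to `A` is open. All the other requirements on a Fell bundle
are inherited from `B`. -/
structure FellSubbundle {G : Type u} [Group G] [TopologicalSpace G] (B : FellBundle.{u, v} G) where
  fiber : ∀ r : G, Submodule ℂ (B.Fiber r)
  isClosed_fiber : ∀ r, IsClosed (fiber r : Set (B.Fiber r))
  mul_mem : ∀ {r s : G} {a : B.Fiber r} {a' : B.Fiber s}, a ∈ fiber r → a' ∈ fiber s →
    B.fmul rfl a a' ∈ fiber (r * s)
  star_mem : ∀ {r : G} {a : B.Fiber r}, a ∈ fiber r → B.fstar rfl a ∈ fiber r⁻¹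
  isOpenMap_restrict : IsOpenMap
    fun a : {b : B.Total // (⟨b, rfl⟩ : B.Fiber (B.proj b)) ∈ fiber (B.proj b)} => B.proj a.1

namespace FellSubbundle

variable {G : Type u} [Group G] [TopologicalSpace G] {B : FellBundle.{u, v} G}

/-- The total space of the subbundle, as a subset of the total space of `B`. -/
def carrier (A : FellSubbundle B) : Set B.Total :=
  {b | (⟨b, rfl⟩ : B.Fiber (B.proj b)) ∈ A.fiber (B.proj b)}

theorem mem_carrier {A : FellSubbundle B} {r : G} (b : B.Fiber r) :
    b.val ∈ A.carrier ↔ b ∈ A.fiber r := by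
  obtain ⟨b, rfl⟩ := b
  rfl

theorem fmul_mem (A : FellSubbundle B) {r s u : G} (h : r * s = u) {a : B.Fiber r}
    {a' : B.Fiber s} (ha : a ∈ A.fiber r) (ha' : a' ∈ A.fiber s) :
    B.fmul h a a' ∈ A.fiber u := by
  subst h; exact A.mul_mem ha ha'

theorem fstar_mem (A : FellSubbundle B) {r s : G} (h : r⁻¹ = s) {a : B.Fiber r}
    (ha : a ∈ A.fiber r) : B.fstar h a ∈ A.fiber s := by
  subst h; exact A.star_mem ha

/-- `𝕄_t(A)`, as a `*`-subalgebra of `𝕄_t(B)`. -/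
def matAlg (A : FellSubbundle B) {n : ℕ} (t : Fin n → G) :
    NonUnitalStarSubalgebra ℂ (B.MatAlg t) where
  carrier := {M | ∀ i j, M i j ∈ A.fiber (t i * (t j)⁻¹)}
  add_mem' hM hN i j := (A.fiber _).add_mem (hM i j) (hN i j)
  zero_mem' _ _ := (A.fiber _).zero_mem
  mul_mem' hM hN i j := (A.fiber _).sum_mem fun k _ => A.fmul_mem _ (hM i k) (hN k j)
  smul_mem' z _ hM i j := (A.fiber _).smul_mem z (hM i j)
  star_mem' hM i j := A.fstar_mem _ (hM j i)

end FellSubbundle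

/-- Conditional expectations from a Fell bundle `B` to a Fell subbundle `A`: continuous idempotent
quasi-linear maps `E : B → A` with `E(B) = A`, `‖E|_{B_e}‖ = 1` and `E(a b a') = a E(b) a'`. -/
structure CondExpectation {G : Type u} [Group G] [TopologicalSpace G] (B : FellBundle.{u, v} G)
    (A : FellSubbundle B) where
  toFun : B.Total → B.Total
  continuous_toFun : Continuous toFun
  proj_toFun : ∀ b, B.proj (toFun b) = B.proj b
  map_add : ∀ {r : G} (b c : B.Fiber r),
    toFun (b + c).val =
      ((⟨toFun b.val, by rw [proj_toFun, b.mem]⟩ : B.Fiber r) +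
        ⟨toFun c.val, by rw [proj_toFun, c.mem]⟩).val
  map_smul : ∀ {r : G} (z : ℂ) (b : B.Fiber r),
    toFun (z • b).val =
      (z • (⟨toFun b.val, by rw [proj_toFun, b.mem]⟩ : B.Fiber r)).val
  idem : ∀ b, toFun (toFun b) = toFun b
  range_eq : Set.range toFun = A.carrier
  /-- the operator norm of the restriction of `E` to `B_e` is `1` -/
  norm_unit : IsLUB {x : ℝ | ∃ b : B.Total, B.proj b = 1 ∧ B.tnorm b ≤ 1 ∧
    x = B.tnorm (toFun b)} 1
  map_bimodule : ∀ a ∈ A.carrier, ∀ b, ∀ a' ∈ A.carrier, toFun (a * b * a') = a * toFun b * a'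

namespace CondExpectation

variable {G : Type u} [Group G] [TopologicalSpace G] {B : FellBundle.{u, v} G}
  {A : FellSubbundle B}

/-- The restriction `E : B_r → B_r`. -/
def onFiber (E : CondExpectation B A) {r : G} (b : B.Fiber r) : B.Fiber r :=
  ⟨E.toFun b.val, by rw [E.proj_toFun, b.mem]⟩

theorem onFiber_mem (E : CondExpectation B A) {r : G} (b : B.Fiber r) :
    E.onFiber b ∈ A.fiber r := by
  rw [← FellSubbundle.mem_carrier, ← E.range_eq]
  exact ⟨b.val, rfl⟩

/-- The entrywise map `E_t : 𝕄_t(B) → 𝕄_t(A)`, `E_t(M)_ij = E(M_ij)`. -/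
noncomputable def onMat (E : CondExpectation B A) {n : ℕ} (t : Fin n → G) :
    B.MatAlg t →ₗ[ℂ] A.matAlg t where
  toFun M := ⟨fun i j => E.onFiber (M i j), fun i j => E.onFiber_mem (M i j)⟩
  map_add' M N := Subtype.ext <| FellBundle.MatAlg.ext fun i j =>
    Fib.ext (E.map_add (M i j) (N i j))
  map_smul' z M := Subtype.ext <| FellBundle.MatAlg.ext fun i j =>
    Fib.ext (E.map_smul z (M i j))

end CondExpectation

/-! Positivity in `𝕄_t(B)` can be read off diagonals, even relative to a closed `*`-subalgebra `S`:
an element `M` of `S` is positive in `S` once all diagonal entries of `Y* M Y`, for `Y ∈ S`, are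
positive in `B_e` (`exists_eq_star_mul_self_of_diag_conj_nonneg`). Polarization gives `M = M*`.
Compressing by the negative part of `M` gives some `-c* c`; the diagonal entries of `c* c` are sums
of positive elements `c_ki* c_ki`, so they can only be `≤ 0` if `c = 0`, and then the negative part
vanishes.

For `S = 𝕄_t(B)` this is the stated criterion, with `y` the `k`-th column of `Y`. For `S = 𝕄_t(A)`
the bimodule property gives `Y* E_t(C* C) Y = E_t((CY)* (CY))`, whose diagonal entries are values of
`E` at positive elements of `B_e`. So positivity of `E_t` reduces to that of `E` on `B_e`, a form of
Tomiyama's theorem (`isPos_map_of_contractive`).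

Two preparations are needed: a C*-norm on `𝕄_t(B)`, obtained from right multiplication on a Hilbert
`B_e`-module, and one-sided module identities for `E`, deduced from the two-sided one by
`eq_zero_of_fmul_eq_zero`. -/

/-! ### Positivity in nonunital C*-algebras; Tomiyama's theorem. -/

section CStarAlgebra

variable {R : Type*} [NonUnitalCStarAlgebra R]

/-- A norm-attaining compression: if `l ≠ 0` lies in the quasispectrum of the self-adjoint `h`,
some self-adjoint contraction `u` satisfies `|s l + t| ≤ ‖s u h u + t u²‖` for all real `s, t`. -/
theorem IsSelfAdjoint.exists_compression {h : R} (hh : IsSelfAdjoint h) {l : ℝ}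
    (hl : l ∈ quasispectrum ℝ h) (hl0 : l ≠ 0) :
    ∃ u : R, IsSelfAdjoint u ∧ ‖u‖ ≤ 1 ∧
      ∀ s t : ℝ, |s * l + t| ≤ ‖s • (u * h * u) + t • (u * u)‖ := by
  -- Take `u = f(h)`, where `f` is `x / l` clamped to `[0, 1]`. Then `s u h u + t u²` is the
  -- function `f(x)² (s x + t)` of `h`, with value `s l + t` at the spectral point `l`; `f(0) = 0`
  -- is what the nonunital calculus requires.
  set f : ℝ → ℝ := fun x => max 0 (min 1 (x / l)) with hf
  have hfc : Continuous f := by fun_prop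
  have hf0 : f 0 = 0 := by simp [f]
  have hfl : f l = 1 := by simp [f, hl0]
  have hfb : ∀ x, ‖f x‖ ≤ 1 := fun x => by
    rw [Real.norm_of_nonneg (le_max_left _ _)]
    exact max_le zero_le_one (min_le_left _ _)
  refine ⟨cfcₙ f h, cfcₙ_predicate f h, norm_cfcₙ_le fun x _ => hfb x, fun s t => ?_⟩
  have e1 : cfcₙ f h * h * cfcₙ f h = cfcₙ (fun x => f x * x * f x) h := by
    conv_lhs => enter [1, 2]; rw [← cfcₙ_id' ℝ h]
    rw [← cfcₙ_mul f (fun x => x) h, ← cfcₙ_mul (fun x => f x * x) f h]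
  have e2 : cfcₙ f h * cfcₙ f h = cfcₙ (fun x => f x * f x) h := by
    rw [← cfcₙ_mul f f h]
  obtain ⟨g₁, hg₁⟩ : ∃ g₁ : ℝ → ℝ, g₁ = fun x => f x * x * f x := ⟨_, rfl⟩
  obtain ⟨g₂, hg₂⟩ : ∃ g₂ : ℝ → ℝ, g₂ = fun x => f x * f x := ⟨_, rfl⟩
  have hg₁c : Continuous g₁ := by rw [hg₁]; fun_prop
  have hg₂c : Continuous g₂ := by rw [hg₂]; fun_prop
  have hg₁0 : g₁ 0 = 0 := by simp [hg₁]
  have hg₂0 : g₂ 0 = 0 := by simp [hg₂, hf0]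
  rw [e1, e2, ← hg₁, ← hg₂, ← cfcₙ_smul s g₁ h hg₁c.continuousOn hg₁0,
    ← cfcₙ_smul t g₂ h hg₂c.continuousOn hg₂0,
    ← cfcₙ_add (fun x => s • g₁ x) (fun x => t • g₂ x) h (hg₁c.const_smul s).continuousOn (by simp [hg₁0])
      (hg₂c.const_smul t).continuousOn (by simp [hg₂0])]
  have := norm_apply_le_norm_cfcₙ (fun x => s • g₁ x + t • g₂ x) h hl
    (by fun_prop) (by simp [hg₁0, hg₂0]) hh
  simpa [hg₁, hg₂, hfl] using this

theorem IsSelfAdjoint.eq_zero_of_quasispectrum {h : R} (hh : IsSelfAdjoint h)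
    (hq : ∀ l ∈ quasispectrum ℝ h, l = 0) : h = 0 := by
  rw [← cfcₙ_id' ℝ h, cfcₙ_congr (g := fun _ => 0) fun l hl => hq l hl]
  exact cfcₙ_zero ℝ h

theorem IsSelfAdjoint.isPos_of_quasispectrum {h : R} (hh : IsSelfAdjoint h)
    (hq : ∀ l ∈ quasispectrum ℝ h, 0 ≤ l) : IsPos h := by
  let _ := CStarAlgebra.spectralOrder R
  have := CStarAlgebra.spectralOrderedRing R
  exact CStarAlgebra.nonneg_iff_eq_star_mul_self.mp
    ((StarOrderedRing.nonneg_iff_quasispectrum_nonneg (R := ℝ) h hh).mpr hq)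

/-- A self-adjoint `a` is positive if no compression `x* a x` is of the form `-c* c`, unless
`c = 0`. -/
theorem IsSelfAdjoint.isPos_of_compression {a : R} (ha : IsSelfAdjoint a)
    (h : ∀ x c : R, star x * a * x = -(star c * c) → c = 0) : IsPos a := by
  let _ := CStarAlgebra.spectralOrder R
  have := CStarAlgebra.spectralOrderedRing R
  have hn : (0 : R) ≤ a⁻ := CFC.negPart_nonneg a
  have hs : star a⁻ = a⁻ := (IsSelfAdjoint.of_nonneg hn).star_eq
  obtain ⟨d, hd⟩ := CStarAlgebra.nonneg_iff_eq_star_mul_self.mp hn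
  -- With `a⁻ = d* d`, compressing by `a⁻` gives `a⁻ a a⁻ = -(a⁻)³ = -(d a⁻)* (d a⁻)`.
  have hc : d * a⁻ = 0 := by
    refine h a⁻ _ ?_
    conv_lhs => enter [1, 2]; rw [← CFC.posPart_sub_negPart a ha]
    rw [mul_sub, sub_mul, hs, CFC.negPart_mul_posPart, zero_mul, zero_sub, star_mul, hs, ← mul_assoc,
      mul_assoc _ (star d) d, ← hd]
  have h2 : a⁻ * a⁻ = 0 := by
    nth_rw 1 [hd]
    rw [mul_assoc, hc, mul_zero]
  have h3 : a⁻ = 0 := by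
    rw [← CStarRing.star_mul_self_eq_zero_iff, hs, h2]
  have h4 : 0 ≤ a := by
    rw [← CFC.posPart_sub_negPart a ha, h3, sub_zero]
    exact CFC.posPart_nonneg a
  exact CStarAlgebra.nonneg_iff_eq_star_mul_self.mp h4

/-- Contractive idempotent bimodule maps onto a C*-subalgebra are positive (the nonunital case of
Tomiyama's theorem). -/
theorem isPos_map_of_contractive (S : NonUnitalStarSubalgebra ℂ R) (hS : IsClosed (S : Set R))
    (E : R →ₗ[ℂ] R) (hmem : ∀ b, E b ∈ S) (hid : ∀ a ∈ S, E a = a) (hE : ∀ b, ‖E b‖ ≤ ‖b‖)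
    (hbi : ∀ a ∈ S, ∀ b, ∀ c ∈ S, E (a * b * c) = a * E b * c) {b : R} (hb : IsPos b) :
    IsPos (E b) := by
  -- Closedness as an instance makes `S` a C*-algebra, so the functional calculus below yields `u ∈
  -- S`, through which `E` can be moved.
  have := hS
  let _ := CStarAlgebra.spectralOrder R
  have := CStarAlgebra.spectralOrderedRing R
  have hb0 : 0 ≤ b := CStarAlgebra.nonneg_iff_eq_star_mul_self.mpr hb
  have hbs : star b = b := (IsSelfAdjoint.of_nonneg hb0).star_eq
  set a : S := ⟨E b, hmem b⟩ with ha
  -- Here `k` is twice the imaginary part of `E b`. The classical argument perturbs `b` by `it·1`;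
  -- without a unit, `u b u + it u²` takes its place.
  have hsa : IsSelfAdjoint a := by
    set k : S := Complex.I • (star a - a) with hk
    have hks : IsSelfAdjoint k := by
      rw [IsSelfAdjoint, hk, star_smul, star_sub, star_star, Complex.star_def, Complex.conj_I,
        neg_smul, ← smul_neg, neg_sub]
    have hk0 : k = 0 := by
      refine hks.eq_zero_of_quasispectrum fun l hl => ?_
      by_contra hl0
      obtain ⟨u, hu, hu1, hul⟩ := hks.exists_compression hl hl0
      have hus : star (u : R) = u := congrArg Subtype.val hu.star_eq
      have key : ∀ t : ℝ, |l + 2 * t| ^ 2 ≤ 4 * (‖b * b‖ + t ^ 2) := by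
        intro t
        obtain ⟨τ, hτ⟩ : ∃ τ : ℂ, τ = Complex.I * t := ⟨_, rfl⟩
        have hτs : star τ = -τ := by
          rw [hτ, star_mul', Complex.star_def, Complex.conj_I, Complex.conj_ofReal, neg_mul]
        have hττ : τ * τ = -((t ^ 2 : ℝ) : ℂ) := by
          rw [hτ]; push_cast; linear_combination (t : ℂ) ^ 2 * Complex.I_mul_I
        set w : R := b * u + τ • (u : R) with hw
        -- The cross terms cancel because `b` is self-adjoint and `τ = it` is imaginary, so `‖w‖²`
        -- is at most `‖b²‖ + t²`.
        have hww : star w * w = u * (b * b) * u + (t ^ 2 : ℝ) • ((u : R) * u) := by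
          simp only [hw, star_add, star_mul, hus, hbs, star_smul, hτs, add_mul, mul_add,
            smul_mul_assoc, mul_smul_comm, smul_smul, mul_assoc, neg_smul, neg_mul, hττ, neg_neg,
            smul_add, smul_neg, Complex.coe_smul]
          abel
        have hwn : ‖w‖ ^ 2 ≤ ‖b * b‖ + t ^ 2 := by
          rw [sq, ← CStarRing.norm_star_mul_self, hww]
          refine (norm_add_le _ _).trans (add_le_add ?_ ?_)
          · refine (norm_mul_le _ _).trans ?_
            refine (mul_le_mul (norm_mul_le _ _) hu1 (norm_nonneg _) (by positivity)).trans ?_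
            rw [mul_one]
            exact mul_le_of_le_one_left (norm_nonneg _) hu1
          · rw [norm_smul, Real.norm_of_nonneg (sq_nonneg t)]
            exact mul_le_of_le_one_right (sq_nonneg t)
              ((norm_mul_le _ _).trans (mul_le_one₀ hu1 (norm_nonneg _) hu1))
        set v : R := u * w with hv
        have hvn : ‖v‖ ≤ ‖w‖ := (norm_mul_le _ _).trans (mul_le_of_le_one_left (norm_nonneg _) hu1)
        have hEv : E v = u * E b * u + τ • ((u : R) * u) := by
          rw [hv, hw, mul_add, ← mul_assoc, mul_smul_comm, _root_.map_add, _root_.map_smul,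
            hbi _ u.2 _ _ u.2, hid _ (S.mul_mem u.2 u.2)]
        have hEn : ‖E v‖ ≤ ‖w‖ := (hE v).trans hvn
        have hkv : ((1 : ℝ) • (u * k * u) + (2 * t) • (u * u) : S) =
            Complex.I • (star (E v) - E v) := by
          have h1 : (k : R) = Complex.I • (star (E b) - E b) := rfl
          have h2 : (((1 : ℝ) • (u * k * u) + (2 * t) • (u * u) : S) : R) =
              (u * k * u : R) + ((2 * t : ℝ) : ℂ) • (u * u : R) := by
            rw [one_smul, Complex.coe_smul]; rfl
          have h3 : ((2 * t : ℝ) : ℂ) = -(Complex.I * τ) - Complex.I * τ := by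
            rw [hτ]; push_cast; linear_combination (2 * t : ℂ) * Complex.I_mul_I
          rw [h2, h1, hEv, h3]
          simp only [star_add, star_smul, star_mul, hus, hτs, smul_sub, smul_add, mul_sub, sub_mul,
            sub_smul, mul_smul_comm, smul_mul_assoc, smul_neg, smul_smul, neg_smul, mul_assoc]
          abel
        have h1 := hul 1 (2 * t)
        rw [one_mul] at h1
        have h2 : ‖((1 : ℝ) • (u * k * u) + (2 * t) • (u * u) : S)‖ ≤ 2 * ‖w‖ := by
          change ‖(((1 : ℝ) • (u * k * u) + (2 * t) • (u * u) : S) : R)‖ ≤ _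
          rw [hkv, norm_smul, Complex.norm_I, one_mul]
          refine (norm_sub_le _ _).trans ?_
          rw [norm_star]; linarith
        have h3 := h1.trans h2
        calc |l + 2 * t| ^ 2 ≤ (2 * ‖w‖) ^ 2 := by gcongr
          _ ≤ _ := by linarith [mul_pow 2 ‖w‖ 2]
      -- After cancelling `4t²`, `key` reads `l² + 4lt ≤ 4‖b²‖`. This `t` makes `lt = ‖b²‖ + 1`.
      have h := key ((‖b * b‖ + 1) / l)
      rw [sq_abs] at h
      have h4 : l * ((‖b * b‖ + 1) / l) = ‖b * b‖ + 1 := by field_simp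
      nlinarith [sq_nonneg l]
    rw [hk, smul_eq_zero, sub_eq_zero] at hk0
    exact hk0.resolve_left Complex.I_ne_zero
  have ha0 : IsPos a := by
    refine hsa.isPos_of_quasispectrum fun l hl => ?_
    by_contra! hl0
    obtain ⟨u, hu, hu1, hul⟩ := hsa.exists_compression hl hl0.ne
    have hus : star (u : R) = u := congrArg Subtype.val hu.star_eq
    have h1 := hul (-1) ‖b‖
    -- Since `0 ≤ v ≤ ‖b‖ u²`, contractivity gives `‖E v‖ ≤ ‖b‖`, whereas a spectral value `l < 0`
    -- of `E b` forces `‖E v‖ ≥ ‖b‖ - l`.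
    set v : R := (‖b‖ : ℝ) • ((u : R) * u) - u * b * u with hv
    have huu : ‖(u : R) * u‖ ≤ 1 := (norm_mul_le _ _).trans (mul_le_one₀ hu1 (norm_nonneg _) hu1)
    have hvn : ‖v‖ ≤ ‖b‖ := by
      have h2 : u * b * u ≤ (‖b‖ : ℝ) • ((u : R) * u) := by
        have := CStarAlgebra.star_left_conjugate_le_norm_smul (a := (u : R)) (b := b) hbs
        rwa [hus] at this
      have h3 : (0 : R) ≤ u * b * u := by
        have := star_left_conjugate_nonneg hb0 (u : R)
        rwa [hus] at this
      refine (CStarAlgebra.norm_le_norm_of_nonneg_of_le (sub_nonneg.mpr h2)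
        (sub_le_self _ h3)).trans ?_
      rw [norm_smul, norm_norm]
      exact mul_le_of_le_one_right (norm_nonneg _) huu
    have hEv : E v = ((-1 : ℝ) • (u * a * u) + ‖b‖ • (u * u) : S) := by
      rw [hv, _root_.map_sub, ← Complex.coe_smul, _root_.map_smul, hbi _ u.2 _ _ u.2,
        hid _ (S.mul_mem u.2 u.2), neg_one_smul, Complex.coe_smul, sub_eq_neg_add]
      rfl
    have h4 : ‖((-1 : ℝ) • (u * a * u) + ‖b‖ • (u * u) : S)‖ ≤ ‖b‖ := by
      change ‖(((-1 : ℝ) • (u * a * u) + ‖b‖ • (u * u) : S) : R)‖ ≤ _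
      rw [← hEv]
      exact (hE v).trans hvn
    have h5 := (le_abs_self _).trans (h1.trans h4)
    linarith
  obtain ⟨c, hc⟩ := ha0
  exact ⟨c, congrArg Subtype.val hc⟩

end CStarAlgebra

/-! ### The C*-algebra `B_e` and the fibres as Hilbert modules over it. -/

namespace FellBundle

variable {G : Type u} [Group G] [TopologicalSpace G] {B : FellBundle.{u, v} G}

section Fibers

theorem norm_fiber {r : G} (b : B.Fiber r) : ‖b‖ = B.tnorm b.val := by
  obtain ⟨b, rfl⟩ := b
  rfl

theorem norm_fmul_le {r s u : G} (h : r * s = u) (b : B.Fiber r) (c : B.Fiber s) :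
    ‖B.fmul h b c‖ ≤ ‖b‖ * ‖c‖ := by
  simp only [norm_fiber]
  exact B.norm_mul_le _ _

theorem norm_fstar_fmul_self {r : G} (b : B.Fiber r) :
    ‖B.fmul (inv_mul_cancel r) (B.fstar rfl b) b‖ = ‖b‖ ^ 2 := by
  simp only [norm_fiber]
  exact B.norm_star_mul_self _

theorem norm_fmul_fstar_self {r : G} (b : B.Fiber r) :
    ‖B.fmul (mul_inv_cancel r) b (B.fstar rfl b)‖ = ‖b‖ ^ 2 := by
  have := B.norm_star_mul_self (star b.val)
  rw [star_star, B.norm_star] at this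
  simp only [norm_fiber]
  exact this

theorem isPos_fstar_fmul_self {r : G} (b : B.Fiber r) :
    IsPos (B.fmul (inv_mul_cancel r) (B.fstar rfl b) b) := by
  obtain ⟨c, hc, h⟩ := B.star_mul_self_pos b.val
  exact ⟨⟨c, hc⟩, Fib.ext h⟩

theorem isPos_fmul_fstar_self {r : G} (b : B.Fiber r) :
    IsPos (B.fmul (mul_inv_cancel r) b (B.fstar rfl b)) := by
  obtain ⟨c, hc, h⟩ := B.star_mul_self_pos (star b.val)
  rw [star_star] at h
  exact ⟨⟨c, hc⟩, Fib.ext h⟩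

variable (B) in
/-- Transport along an equality of group elements. -/
def fcast {r s : G} (h : r = s) : B.Fiber r →ₗ[ℂ] B.Fiber s where
  toFun b := ⟨b.val, b.mem.trans h⟩
  map_add' b c := by subst h; rfl
  map_smul' z b := by subst h; rfl

theorem norm_fcast {r s : G} (h : r = s) (b : B.Fiber r) : ‖B.fcast h b‖ = ‖b‖ := by
  subst h; rfl

noncomputable instance unitFiberRing : NonUnitalRing (B.Fiber (1 : G)) where
  left_distrib := fmul_add _
  right_distrib := add_fmul _
  zero_mul b := by
    have h : (0 + 0 : B.Fiber (1 : G)) * b = 0 * b + 0 * b := add_fmul _ 0 0 b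
    rw [add_zero] at h
    exact left_eq_add.mp h
  mul_zero b := by
    have h : b * (0 + 0 : B.Fiber (1 : G)) = b * 0 + b * 0 := fmul_add _ b 0 0
    rw [add_zero] at h
    exact left_eq_add.mp h
  mul_assoc a b c := Fib.ext (_root_.mul_assoc a.val b.val c.val)

instance unitFiberStarRing : StarRing (B.Fiber (1 : G)) where
  star_involutive b := Fib.ext (star_star b.val)
  star_mul b c := Fib.ext (StarMul.star_mul b.val c.val)
  star_add := fstar_add _

noncomputable instance unitFiberCStarAlgebra : NonUnitalCStarAlgebra (B.Fiber (1 : G)) where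
  __ := B.fibNormed 1
  __ := B.fibSpace 1
  __ := unitFiberRing
  __ := unitFiberStarRing
  dist_eq := (B.fibNormed 1).dist_eq
  norm_mul_le := norm_fmul_le _
  complete := (B.fibComplete 1).complete
  norm_mul_self_le b := ((norm_fstar_fmul_self b).trans (sq _)).ge
  smul_assoc := smul_fmul _
  smul_comm z b c := (fmul_smul _ z b c).symm
  star_smul := fstar_smul _

noncomputable instance unitFiberPartialOrder : PartialOrder (B.Fiber (1 : G)) :=
  CStarAlgebra.spectralOrder _

instance unitFiberStarOrderedRing : StarOrderedRing (B.Fiber (1 : G)) :=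
  CStarAlgebra.spectralOrderedRing _

theorem nonneg_iff_isPos {b : B.Fiber (1 : G)} : 0 ≤ b ↔ IsPos b :=
  CStarAlgebra.nonneg_iff_eq_star_mul_self

theorem fstar_fmul_self_eq_zero {r : G} {b : B.Fiber r}
    (h : B.fmul (inv_mul_cancel r) (B.fstar rfl b) b = 0) : b = 0 := by
  have := norm_fstar_fmul_self b
  rw [h, norm_zero] at this
  exact norm_eq_zero.mp (pow_eq_zero_iff two_ne_zero |>.mp this.symm)

/-- The left Hilbert `B_e`-module `B_r`, with inner product `⟨x, y⟩ = y x*`. -/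
instance fiberSMul (r : G) : SMul (B.Fiber (1 : G)) (B.Fiber r) :=
  ⟨fun a b => B.fmul (one_mul r) a b⟩

/-- Positivity of `⟨x, x⟩ = x x*` is the positivity axiom of the Fell bundle applied to `x*`. -/
noncomputable instance fiberCStarModule (r : G) : CStarModule (B.Fiber (1 : G)) (B.Fiber r) where
  inner x y := B.fmul (mul_inv_cancel r) y (B.fstar rfl x)
  inner_add_right := add_fmul _ _ _ _
  inner_self_nonneg := nonneg_iff_isPos.mpr (isPos_fmul_fstar_self _)
  inner_self {x} := by
    refine ⟨fun h => ?_, fun h => ?_⟩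
    · have := norm_fmul_fstar_self x
      rw [h, norm_zero] at this
      exact norm_eq_zero.mp (pow_eq_zero_iff two_ne_zero |>.mp this.symm)
    · rw [← norm_eq_zero, norm_fmul_fstar_self, h, norm_zero, sq, zero_mul]
  inner_op_smul_right {a x y} := Fib.ext (_root_.mul_assoc a.val y.val (star x.val))
  inner_smul_right_complex := smul_fmul _ _ _ _
  star_inner x y := Fib.ext <| by
    change star (y.val * star x.val) = x.val * star y.val
    rw [StarMul.star_mul, star_star]
  norm_eq_sqrt_norm_inner_self x := by
    rw [norm_fmul_fstar_self, Real.sqrt_sq (norm_nonneg _)]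

end Fibers

/-! ### The C*-norm of `𝕄_t(B)`. -/

section Matrices

open WithCStarModule

variable {n : ℕ} {t : Fin n → G}

/-- The diagonal entries of a matrix, as elements of `B_e`. -/
def diag (i : Fin n) : B.MatAlg t →ₗ[ℂ] B.Fiber (1 : G) where
  toFun M := B.fcast (mul_inv_cancel (t i)) (M i i)
  map_add' M N := by rw [MatAlg.add_apply, _root_.map_add]
  map_smul' z M := by rw [MatAlg.smul_apply, _root_.map_smul, RingHom.id_apply]

theorem norm_diag (i : Fin n) (M : B.MatAlg t) : ‖diag i M‖ = ‖M i i‖ :=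
  norm_fcast (mul_inv_cancel (t i)) _

theorem diag_star_mul_self (i : Fin n) (X : B.MatAlg t) :
    diag i (star X * X) = ∑ k, B.fmul (inv_mul_cancel _) (B.fstar rfl (X k i)) (X k i) := by
  change B.fcast (mul_inv_cancel (t i)) ((star X * X) i i) = _
  rw [MatAlg.mul_apply, map_sum]
  rfl

theorem diag_mul_star (i : Fin n) (X Y : B.MatAlg t) :
    diag i (Y * star X) = ∑ k, B.fmul (mul_inv_cancel _) (Y i k) (B.fstar rfl (X i k)) := by
  change B.fcast (mul_inv_cancel (t i)) ((Y * star X) i i) = _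
  rw [MatAlg.mul_apply, map_sum]
  rfl

theorem diag_star_mul_self_nonneg (i : Fin n) (X : B.MatAlg t) : 0 ≤ diag i (star X * X) := by
  rw [diag_star_mul_self]
  exact Finset.sum_nonneg fun k _ => nonneg_iff_isPos.mpr (isPos_fstar_fmul_self _)

/-- The `i`-th diagonal entry of `X* X` is the sum over `k` of the positive elements `X_ki* X_ki`,
so all of them vanish. -/
theorem eq_zero_of_diag_star_mul_self {X : B.MatAlg t} (h : ∀ i, diag i (star X * X) ≤ 0) :
    X = 0 := by
  refine MatAlg.ext fun k i => fstar_fmul_self_eq_zero ?_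
  have h0 := le_antisymm (h i) (diag_star_mul_self_nonneg i X)
  rw [diag_star_mul_self, Finset.sum_eq_zero_iff_of_nonneg
    fun k _ => nonneg_iff_isPos.mpr (isPos_fstar_fmul_self _)] at h0
  exact h0 k (Finset.mem_univ k)

variable (B t) in
/-- `𝕄_t(B)` as a left Hilbert `B_e`-module, with inner product `⟨X, Y⟩ = Tr (Y X*)`. -/
def HilbMod : Type v :=
  C⋆ᵐᵒᵈ(B.Fiber (1 : G), ∀ p : Fin n × Fin n, B.Fiber (t p.1 * (t p.2)⁻¹))

noncomputable instance : NormedAddCommGroup (B.HilbMod t) :=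
  inferInstanceAs (NormedAddCommGroup
    C⋆ᵐᵒᵈ(B.Fiber (1 : G), ∀ p : Fin n × Fin n, B.Fiber (t p.1 * (t p.2)⁻¹)))

noncomputable instance : NormedSpace ℂ (B.HilbMod t) :=
  inferInstanceAs (NormedSpace ℂ
    C⋆ᵐᵒᵈ(B.Fiber (1 : G), ∀ p : Fin n × Fin n, B.Fiber (t p.1 * (t p.2)⁻¹)))

instance : CompleteSpace (B.HilbMod t) :=
  inferInstanceAs (CompleteSpace
    C⋆ᵐᵒᵈ(B.Fiber (1 : G), ∀ p : Fin n × Fin n, B.Fiber (t p.1 * (t p.2)⁻¹)))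

instance : SMul (B.Fiber (1 : G)) (B.HilbMod t) :=
  inferInstanceAs (SMul (B.Fiber (1 : G))
    C⋆ᵐᵒᵈ(B.Fiber (1 : G), ∀ p : Fin n × Fin n, B.Fiber (t p.1 * (t p.2)⁻¹)))

noncomputable instance : CStarModule (B.Fiber (1 : G)) (B.HilbMod t) :=
  inferInstanceAs (CStarModule (B.Fiber (1 : G))
    C⋆ᵐᵒᵈ(B.Fiber (1 : G), ∀ p : Fin n × Fin n, B.Fiber (t p.1 * (t p.2)⁻¹)))

variable (B t) in
/-- The identification of `𝕄_t(B)` with the Hilbert module it carries. -/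
noncomputable def toHilb : B.MatAlg t ≃ₗ[ℂ] B.HilbMod t where
  toFun M := (equiv _ _).symm fun p => M p.1 p.2
  invFun x i j := x (i, j)
  map_add' _ _ := rfl
  map_smul' _ _ := rfl
  left_inv _ := rfl
  right_inv _ := rfl

theorem inner_toHilb (X Y : B.MatAlg t) :
    inner (B.Fiber (1 : G)) (toHilb B t X) (toHilb B t Y) = ∑ i, diag i (Y * star X) := by
  simp only [diag_mul_star]
  exact Fintype.sum_prod_type _

theorem norm_apply_le_norm_toHilb (M : B.MatAlg t) (i j : Fin n) : ‖M i j‖ ≤ ‖toHilb B t M‖ :=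
  norm_apply_le_norm
    (show C⋆ᵐᵒᵈ(B.Fiber (1 : G), ∀ p : Fin n × Fin n, B.Fiber (t p.1 * (t p.2)⁻¹)) from
      toHilb B t M) (i, j)

theorem norm_toHilb_le (M : B.MatAlg t) : ‖toHilb B t M‖ ≤ ∑ i, ∑ j, ‖M i j‖ := by
  refine (pi_norm_le_sum_norm
    (show C⋆ᵐᵒᵈ(B.Fiber (1 : G), ∀ p : Fin n × Fin n, B.Fiber (t p.1 * (t p.2)⁻¹)) from
      toHilb B t M)).trans_eq ?_
  exact Fintype.sum_prod_type _

/-- A crude bound, with one term for each triple `(i, j, k)`; only boundedness matters. -/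
theorem norm_toHilb_mul_le (X M : B.MatAlg t) :
    ‖toHilb B t (X * M)‖ ≤ (n ^ 3 * ‖toHilb B t M‖) * ‖toHilb B t X‖ := by
  calc _ ≤ ∑ i : Fin n, ∑ j : Fin n, ∑ k : Fin n, ‖toHilb B t X‖ * ‖toHilb B t M‖ := by
        refine (norm_toHilb_le _).trans ?_
        gcongr with i _ j _
        rw [MatAlg.mul_apply]
        refine (norm_sum_le _ _).trans ?_
        gcongr with k _
        refine (norm_fmul_le _ _ _).trans ?_
        gcongr <;> exact norm_apply_le_norm_toHilb _ _ _
    _ = _ := by simp; ring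

variable (B t) in
/-- The action of `𝕄_t(B)` on its Hilbert module by right multiplication. -/
noncomputable def rightMul : B.MatAlg t →ₗ[ℂ] B.HilbMod t →L[ℂ] B.HilbMod t where
  toFun M := LinearMap.mkContinuous
    ((toHilb B t).toLinearMap ∘ₗ LinearMap.mulRight ℂ M ∘ₗ (toHilb B t).symm.toLinearMap)
    (n ^ 3 * ‖toHilb B t M‖) fun x => by
      obtain ⟨X, rfl⟩ := (toHilb B t).surjective x
      simpa using norm_toHilb_mul_le X M
  map_add' M N := by
    ext x : 1
    simp [_root_.mul_add]
  map_smul' z M := by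
    ext x : 1
    simp [mul_smul_comm]

theorem rightMul_toHilb (M X : B.MatAlg t) : rightMul B t M (toHilb B t X) = toHilb B t (X * M) := by
  simp [rightMul]

theorem rightMul_mul (M N : B.MatAlg t) : rightMul B t (M * N) = rightMul B t N * rightMul B t M := by
  ext x : 1
  obtain ⟨X, rfl⟩ := (toHilb B t).surjective x
  rw [mul_apply_eq_comp, rightMul_toHilb, rightMul_toHilb, rightMul_toHilb, mul_assoc]

theorem norm_rightMul_le (M : B.MatAlg t) : ‖rightMul B t M‖ ≤ n ^ 3 * ‖toHilb B t M‖ :=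
  ContinuousLinearMap.opNorm_le_bound _ (by positivity) fun x => by
    obtain ⟨X, rfl⟩ := (toHilb B t).surjective x
    rw [rightMul_toHilb]
    exact norm_toHilb_mul_le X M

/-- Associativity suffices: `Y (X M)* = (Y M*) X*`. -/
theorem inner_rightMul (M : B.MatAlg t) (x y : B.HilbMod t) :
    inner (B.Fiber (1 : G)) (rightMul B t M x) y =
      inner (B.Fiber (1 : G)) x (rightMul B t (star M) y) := by
  obtain ⟨X, rfl⟩ := (toHilb B t).surjective x
  obtain ⟨Y, rfl⟩ := (toHilb B t).surjective y
  rw [rightMul_toHilb, rightMul_toHilb, inner_toHilb, inner_toHilb, star_mul, mul_assoc]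

/-- Cauchy–Schwarz applied to `⟨xM, xM⟩ = ⟨x, x M M*⟩`. -/
theorem norm_rightMul_sq_le (M : B.MatAlg t) :
    ‖rightMul B t M‖ ^ 2 ≤ ‖rightMul B t (M * star M)‖ := by
  have h : ∀ x, ‖rightMul B t M x‖ ^ 2 ≤ ‖rightMul B t (M * star M)‖ * ‖x‖ ^ 2 := fun x => by
    rw [CStarModule.norm_sq_eq (B.Fiber (1 : G)), inner_rightMul, ← mul_apply_eq_comp,
      ← rightMul_mul]
    refine (CStarModule.norm_inner_le _).trans ?_
    calc _ ≤ ‖x‖ * (‖rightMul B t (M * star M)‖ * ‖x‖) := by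
          gcongr; exact ContinuousLinearMap.le_opNorm _ _
      _ = _ := by ring
  refine (Real.le_sqrt (norm_nonneg _) (norm_nonneg _)).mp ?_
  refine ContinuousLinearMap.opNorm_le_bound _ (Real.sqrt_nonneg _) fun x => ?_
  rw [← Real.sqrt_sq (norm_nonneg x), ← Real.sqrt_mul (norm_nonneg _)]
  exact Real.le_sqrt_of_sq_le (h x)

/-- With no unit available as a test vector, the operator is applied to `M*` itself: `⟨M*, M*⟩` is
the sum of the `n` diagonal entries of `M* M`, the image of `M*`. Cancelling one factor `‖M*‖`
leaves the bound. It makes the representation faithful and its norm complete. -/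
theorem norm_toHilb_star_le (M : B.MatAlg t) : ‖toHilb B t (star M)‖ ≤ n * ‖rightMul B t M‖ := by
  have h : ‖toHilb B t (star M)‖ ^ 2 ≤ (n * ‖rightMul B t M‖) * ‖toHilb B t (star M)‖ := by
    rw [CStarModule.norm_sq_eq (B.Fiber (1 : G)), inner_toHilb, star_star, mul_assoc]
    calc _ ≤ ∑ i : Fin n, ‖rightMul B t M (toHilb B t (star M))‖ := by
          refine (norm_sum_le _ _).trans ?_
          gcongr with i _
          rw [norm_diag, rightMul_toHilb]
          exact norm_apply_le_norm_toHilb _ _ _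
      _ = n * ‖rightMul B t M (toHilb B t (star M))‖ := by simp
      _ ≤ _ := by gcongr; exact ContinuousLinearMap.le_opNorm _ _
  rw [sq] at h
  rcases (norm_nonneg (toHilb B t (star M))).eq_or_lt' with h0 | h0
  · rw [h0]; positivity
  · exact le_of_mul_le_mul_right h h0

theorem norm_rightMul_star_le (M : B.MatAlg t) : ‖rightMul B t M‖ ≤ ‖rightMul B t (star M)‖ := by
  have h := norm_rightMul_sq_le M
  rw [rightMul_mul, sq] at h
  rcases (norm_nonneg (rightMul B t M)).eq_or_lt' with h0 | h0
  · rw [h0]; positivity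
  · exact le_of_mul_le_mul_right (h.trans (_root_.norm_mul_le _ _)) h0

theorem norm_toHilb_le_norm_rightMul (M : B.MatAlg t) :
    ‖toHilb B t M‖ ≤ n * ‖rightMul B t M‖ := by
  have := norm_toHilb_star_le (star M)
  rw [star_star] at this
  refine this.trans ?_
  gcongr
  simpa using norm_rightMul_star_le (star M)

variable (B t) in
/-- Right multiplication as a ring homomorphism to the opposite of the operator algebra. -/
noncomputable def rightMulHom : B.MatAlg t →ₙ+* (B.HilbMod t →L[ℂ] B.HilbMod t)ᵐᵒᵖ where
  toFun M := MulOpposite.op (rightMul B t M)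
  map_mul' M N := by rw [rightMul_mul, MulOpposite.op_mul]
  map_zero' := by rw [_root_.map_zero, MulOpposite.op_zero]
  map_add' M N := by rw [_root_.map_add, MulOpposite.op_add]

theorem rightMulHom_injective : Function.Injective (rightMulHom B t) := by
  refine (injective_iff_map_eq_zero _).mpr fun M hM => ?_
  have h0 : rightMul B t M = 0 := MulOpposite.op_injective hM
  have h := norm_toHilb_le_norm_rightMul M
  rw [h0, norm_zero, mul_zero] at h
  exact (toHilb B t).map_eq_zero_iff.mp (norm_le_zero_iff.mp h)

/-- The C*-norm of `𝕄_t(B)`: the operator norm on the Hilbert module. -/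
noncomputable instance : NonUnitalNormedRing (B.MatAlg t) :=
  NonUnitalNormedRing.induced (B.MatAlg t) _ (rightMulHom B t) rightMulHom_injective

theorem norm_eq_norm_rightMul (M : B.MatAlg t) : ‖M‖ = ‖rightMul B t M‖ := rfl

noncomputable instance : NormedSpace ℂ (B.MatAlg t) where
  norm_smul_le z M := by
    rw [norm_eq_norm_rightMul, norm_eq_norm_rightMul, _root_.map_smul]
    exact norm_smul_le z (rightMul B t M)

variable (B t) in
/-- The C*-norm of `𝕄_t(B)` is equivalent to its Hilbert module norm. -/
noncomputable def toHilbL : B.MatAlg t ≃L[ℂ] B.HilbMod t :=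
  (toHilb B t).toContinuousLinearEquivOfBounds n (n ^ 3) norm_toHilb_le_norm_rightMul fun x => by
    have := norm_rightMul_le ((toHilb B t).symm x)
    rwa [LinearEquiv.apply_symm_apply] at this

instance : CompleteSpace (B.MatAlg t) :=
  (completeSpace_congr (e := (toHilbL B t).toEquiv) (toHilbL B t).isUniformEmbedding).mpr inferInstance

noncomputable instance : NonUnitalCStarAlgebra (B.MatAlg t) where
  norm_mul_self_le M := by
    have h := norm_rightMul_sq_le (star M)
    rw [star_star, sq] at h
    refine le_trans ?_ h
    have := norm_rightMul_star_le M
    exact mul_self_le_mul_self (norm_nonneg _) this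

theorem continuous_entry (i j : Fin n) : Continuous fun M : B.MatAlg t => M i j := by
  refine (LipschitzWith.of_dist_le_mul (K := n) fun M N => ?_).continuous
  rw [dist_eq_norm, dist_eq_norm]
  exact (norm_apply_le_norm_toHilb (M - N) i j).trans (norm_toHilb_le_norm_rightMul (M - N))

end Matrices

end FellBundle

/-! ### Positivity tested on diagonals. -/

namespace FellBundle

variable {G : Type u} [Group G] [TopologicalSpace G] {B : FellBundle.{u, v} G} {n : ℕ}
  {t : Fin n → G}

theorem fmul_sub {r s u : G} (h : r * s = u) (b : B.Fiber r) (c d : B.Fiber s) :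
    B.fmul h b (c - d) = B.fmul h b c - B.fmul h b d :=
  _root_.map_sub (AddMonoidHom.mk' (B.fmul h b) (fmul_add h b)) c d

theorem sub_fmul {r s u : G} (h : r * s = u) (b c : B.Fiber r) (d : B.Fiber s) :
    B.fmul h (b - c) d = B.fmul h b d - B.fmul h c d :=
  _root_.map_sub (AddMonoidHom.mk' (fun b => B.fmul h b d) (fun b b' => add_fmul h b b' d)) b c

theorem diag_star (i : Fin n) (M : B.MatAlg t) : diag i (star M) = star (diag i M) := rfl

theorem diag_conj_eq_quadForm (k : Fin n) (M Y : B.MatAlg t) :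
    diag k (star Y * M * Y) = B.quadForm t (t k)⁻¹ M fun i => Y i k := by
  rw [_root_.mul_assoc]
  change B.fcast (mul_inv_cancel (t k)) ((star Y * (M * Y)) k k) = _
  rw [MatAlg.mul_apply, map_sum, quadForm]
  refine Finset.sum_congr rfl fun i _ => ?_
  rw [MatAlg.mul_apply, fmul_sum, map_sum]
  rfl

theorem diag_conj_star_mul_self_nonneg (k : Fin n) (C Y : B.MatAlg t) :
    0 ≤ diag k (star Y * (star C * C) * Y) := by
  have h : star Y * (star C * C) * Y = star (C * Y) * (C * Y) := by
    simp only [star_mul, _root_.mul_assoc]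
  rw [h]
  exact diag_star_mul_self_nonneg k _

/-- The form of `D = M - M*` vanishes on `S`. Polarizing with `Y + Z` and `Y + iZ`, then taking `Z =
D Y`, gives `D Y = 0`; finally `Y = D*`. All test matrices stay in `S`. -/
theorem star_eq_of_diag_conj_nonneg (S : NonUnitalStarSubalgebra ℂ (B.MatAlg t)) {M : B.MatAlg t}
    (hM : M ∈ S) (h : ∀ Y ∈ S, ∀ k, 0 ≤ diag k (star Y * M * Y)) : star M = M := by
  set D := M - star M with hD
  have hDS : D ∈ S := sub_mem hM (star_mem hM)
  have q : ∀ Y ∈ S, ∀ k, diag k (star Y * D * Y) = 0 := fun Y hY k => by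
    have h1 : star Y * star M * Y = star (star Y * M * Y) := by
      simp only [star_mul, star_star, _root_.mul_assoc]
    rw [hD, _root_.mul_sub, _root_.sub_mul, _root_.map_sub, h1, diag_star,
      (IsSelfAdjoint.of_nonneg (h Y hY k)).star_eq, sub_self]
  have pol : ∀ Y ∈ S, ∀ Z ∈ S, ∀ k, diag k (star Z * D * Y) = 0 := fun Y hY Z hZ k => by
    have h1 := q (Y + Z) (add_mem hY hZ) k
    have h2 := q (Y + Complex.I • Z) (add_mem hY (SMulMemClass.smul_mem _ hZ)) k
    simp only [StarAddMonoid.star_add, StarModule.star_smul, _root_.mul_add, _root_.add_mul, smul_mul_assoc,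
      mul_smul_comm, _root_.map_add, _root_.map_smul, q Y hY k, q Z hZ k, smul_zero, zero_add,
      add_zero, Complex.star_def, Complex.conj_I,
      neg_smul, _root_.neg_mul, _root_.map_neg, neg_zero] at h1 h2
    rw [neg_add_eq_sub, ← smul_sub, smul_eq_zero, sub_eq_zero] at h2
    rw [h2.resolve_left Complex.I_ne_zero, ← two_smul ℂ, smul_eq_zero] at h1
    exact h1.resolve_left two_ne_zero
  have hDY : ∀ Y ∈ S, D * Y = 0 := fun Y hY => by
    refine eq_zero_of_diag_star_mul_self fun k => ?_
    rw [← _root_.mul_assoc, pol Y hY (D * Y) (S.mul_mem hDS hY) k]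
  have hD0 : D = 0 := by
    rw [← CStarRing.mul_star_self_eq_zero_iff]
    exact hDY _ (star_mem hDS)
  exact (sub_eq_zero.mp hD0).symm

/-- The positivity criterion relative to a C*-subalgebra of `𝕄_t(B)`. -/
theorem exists_eq_star_mul_self_of_diag_conj_nonneg (S : NonUnitalStarSubalgebra ℂ (B.MatAlg t))
    (hS : IsClosed (S : Set (B.MatAlg t))) (M : S)
    (h : ∀ Y ∈ S, ∀ k, 0 ≤ diag k (star Y * (M : B.MatAlg t) * Y)) : IsPos M := by
  have := hS
  have hs : IsSelfAdjoint M := Subtype.ext (star_eq_of_diag_conj_nonneg S M.2 h)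
  -- If `x* M x = -c* c`, the diagonal of `c* c` is `≤ 0`, so `c = 0`.
  refine hs.isPos_of_compression fun x c hxc => Subtype.ext ?_
  refine eq_zero_of_diag_star_mul_self fun k => ?_
  have h1 : star (x : B.MatAlg t) * M * x = -(star (c : B.MatAlg t) * c) :=
    congrArg Subtype.val hxc
  have h2 := h x x.2 k
  rwa [h1, _root_.map_neg, Left.nonneg_neg_iff] at h2

theorem isPos_iff_quadForm (M : B.MatAlg t) :
    IsPos M ↔ ∀ (k : Fin n) (y : B.Y fun i => t i * (t k)⁻¹),
      IsPos (B.quadForm t (t k)⁻¹ M y) := by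
  refine ⟨?_, fun h => ?_⟩
  · rintro ⟨C, rfl⟩ k y
    -- The matrix with `k`-th column `y` and zeros elsewhere.
    obtain ⟨Y, rfl⟩ : ∃ Y : B.MatAlg t, (fun i => Y i k) = y :=
      ⟨fun i => Function.update 0 k (y i), funext fun i =>
        Function.update_self (β := fun j => B.Fiber (t i * (t j)⁻¹)) k (y i) 0⟩
    rw [← diag_conj_eq_quadForm, ← nonneg_iff_isPos]
    exact diag_conj_star_mul_self_nonneg k C Y
  · obtain ⟨c, hc⟩ := exists_eq_star_mul_self_of_diag_conj_nonneg ⊤ isClosed_univ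
      ⟨M, trivial⟩ fun Y _ k => by
        rw [diag_conj_eq_quadForm]
        exact nonneg_iff_isPos.mpr (h k _)
    exact ⟨c, congrArg Subtype.val hc⟩

end FellBundle

/-! ### Closedness of `𝕄_t(A)`, and separation of points of `A` by two-sided products. -/

namespace FellSubbundle

variable {G : Type u} [Group G] [TopologicalSpace G] {B : FellBundle.{u, v} G}
  (A : FellSubbundle B)

/-- The unit fibre `A_e`, as a `*`-subalgebra of `B_e`. -/
def unitFiber : NonUnitalStarSubalgebra ℂ (B.Fiber (1 : G)) where
  carrier := A.fiber 1
  add_mem' := (A.fiber 1).add_mem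
  zero_mem' := (A.fiber 1).zero_mem
  mul_mem' := A.fmul_mem _
  smul_mem' z _ := (A.fiber 1).smul_mem z
  star_mem' := A.fstar_mem _

theorem isClosed_matAlg {n : ℕ} (t : Fin n → G) : IsClosed (A.matAlg t : Set (B.MatAlg t)) := by
  have : (A.matAlg t : Set (B.MatAlg t)) =
      ⋂ i, ⋂ j, (fun M : B.MatAlg t => M i j) ⁻¹' (A.fiber (t i * (t j)⁻¹)) := by
    ext M
    simp only [Set.mem_iInter]
    rfl
  rw [this]
  exact isClosed_iInter fun i => isClosed_iInter fun j =>
    (A.isClosed_fiber _).preimage (FellBundle.continuous_entry i j)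

/-- Put `w = z* z`. The choice `c = z*`, `d = w*` gives `w w* = 0`, hence `w = 0` and `z = 0`. This
replaces an approximate unit. -/
theorem eq_zero_of_fmul_eq_zero {r : G} {z : B.Fiber r} (hz : z ∈ A.fiber r)
    (h : ∀ (p q : G) (c : B.Fiber p) (d : B.Fiber q), c ∈ A.fiber p → d ∈ A.fiber q →
      B.fmul rfl (B.fmul rfl c z) d = 0) : z = 0 := by
  refine FellBundle.fstar_fmul_self_eq_zero ?_
  set w := B.fmul (inv_mul_cancel r) (B.fstar rfl z) z with hw
  have hwA : star w ∈ A.fiber 1 :=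
    A.fstar_mem _ (A.fmul_mem _ (A.fstar_mem _ hz) hz)
  rw [← CStarRing.mul_star_self_eq_zero_iff]
  have h1 := congrArg (B.fcast (show r⁻¹ * r * 1 = 1 by group))
    (h r⁻¹ 1 (B.fstar rfl z) (star w) (A.fstar_mem _ hz) hwA)
  rw [_root_.map_zero] at h1
  exact h1

end FellSubbundle

/-! ### One-sided module identities for `E`, and positivity of `E_t`. -/

namespace CondExpectation

variable {G : Type u} [Group G] [TopologicalSpace G] {B : FellBundle.{u, v} G}
  {A : FellSubbundle B} (E : CondExpectation B A)

/-- The restriction of `E` to a fibre, as a linear map. -/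
def onFiberₗ (r : G) : B.Fiber r →ₗ[ℂ] B.Fiber r where
  toFun := E.onFiber
  map_add' b c := Fib.ext (E.map_add b c)
  map_smul' z b := Fib.ext (E.map_smul z b)

theorem onFiber_sum {r : G} {ι : Type*} (s : Finset ι) (f : ι → B.Fiber r) :
    E.onFiber (∑ i ∈ s, f i) = ∑ i ∈ s, E.onFiber (f i) :=
  map_sum (E.onFiberₗ r) f s

theorem onFiber_eq_self {r : G} {a : B.Fiber r} (ha : a ∈ A.fiber r) : E.onFiber a = a := by
  rw [← FellSubbundle.mem_carrier, ← E.range_eq] at ha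
  obtain ⟨b, hb⟩ := ha
  refine Fib.ext ?_
  change E.toFun a.val = a.val
  rw [← hb, E.idem]

theorem onFiber_fmul_fmul {p r q u w : G} (h : p * r = u) (h' : u * q = w) {c : B.Fiber p}
    (b : B.Fiber r) {d : B.Fiber q} (hc : c ∈ A.fiber p) (hd : d ∈ A.fiber q) :
    E.onFiber (B.fmul h' (B.fmul h c b) d) = B.fmul h' (B.fmul h c (E.onFiber b)) d :=
  Fib.ext (E.map_bimodule _ ((FellSubbundle.mem_carrier c).mpr hc) _ _
    ((FellSubbundle.mem_carrier d).mpr hd))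

/-- Both sides lie in `A`, and for `c`, `d` in `A` the two-sided identity gives `c E(ab) d = E(cabd)
= (ca) E(b) d`. -/
theorem onFiber_fmul_left {r s u : G} (h : r * s = u) {a : B.Fiber r} (ha : a ∈ A.fiber r)
    (b : B.Fiber s) : E.onFiber (B.fmul h a b) = B.fmul h a (E.onFiber b) := by
  subst h
  rw [← sub_eq_zero]
  refine A.eq_zero_of_fmul_eq_zero ((A.fiber _).sub_mem (E.onFiber_mem _)
    (A.fmul_mem _ ha (E.onFiber_mem b))) fun p q c d hc hd => ?_
  rw [FellBundle.fmul_sub, FellBundle.sub_fmul, sub_eq_zero, ← E.onFiber_fmul_fmul _ _ _ hc hd]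
  have h1 : p * r * s = p * (r * s) := mul_assoc _ _ _
  have h2 := E.onFiber_fmul_fmul h1 rfl b (A.fmul_mem rfl hc ha) hd
  have h3 : ∀ x : B.Fiber s, B.fmul h1 (B.fmul rfl c a) x = B.fmul rfl c (B.fmul rfl a x) :=
    fun x => Fib.ext (mul_assoc c.val a.val x.val)
  rwa [h3, h3] at h2

theorem onFiber_fmul_right {r s u : G} (h : r * s = u) (b : B.Fiber r) {a : B.Fiber s}
    (ha : a ∈ A.fiber s) : E.onFiber (B.fmul h b a) = B.fmul h (E.onFiber b) a := by
  subst h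
  rw [← sub_eq_zero]
  refine A.eq_zero_of_fmul_eq_zero ((A.fiber _).sub_mem (E.onFiber_mem _)
    (A.fmul_mem _ (E.onFiber_mem b) ha)) fun p q c d hc hd => ?_
  rw [FellBundle.fmul_sub, FellBundle.sub_fmul, sub_eq_zero, ← E.onFiber_fmul_fmul _ _ _ hc hd]
  have h1 : p * r * (s * q) = p * (r * s) * q := by group
  have h2 := E.onFiber_fmul_fmul rfl h1 b hc (A.fmul_mem rfl ha hd)
  have h3 : ∀ x : B.Fiber r, B.fmul h1 (B.fmul rfl c x) (B.fmul rfl a d) =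
      B.fmul rfl (B.fmul rfl c (B.fmul rfl x a)) d := fun x => Fib.ext <| by
    change c.val * x.val * (a.val * d.val) = c.val * (x.val * a.val) * d.val
    simp only [mul_assoc]
  rwa [h3, h3] at h2

theorem norm_onFiber_unit_le (b : B.Fiber (1 : G)) : ‖E.onFiber b‖ ≤ ‖b‖ := by
  have h1 : ∀ c : B.Fiber (1 : G), ‖c‖ ≤ 1 → ‖E.onFiber c‖ ≤ 1 := fun c hc =>
    E.norm_unit.1 ⟨c.val, c.mem, by rwa [← FellBundle.norm_fiber],
      FellBundle.norm_fiber (E.onFiber c)⟩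
  rcases eq_or_ne b 0 with rfl | hb
  · exact (congrArg norm (_root_.map_zero (E.onFiberₗ 1))).le.trans (by simp)
  · have hb' := norm_pos_iff.mpr hb
    have h2 := h1 (((‖b‖⁻¹ : ℝ) : ℂ) • b) (by
      rw [norm_smul, Complex.norm_real, norm_inv, norm_norm, inv_mul_cancel₀ hb'.ne'])
    have h3 : E.onFiber (((‖b‖⁻¹ : ℝ) : ℂ) • b) = ((‖b‖⁻¹ : ℝ) : ℂ) • E.onFiber b :=
      _root_.map_smul (E.onFiberₗ 1) _ _
    rw [h3, norm_smul, Complex.norm_real, norm_inv, norm_norm, inv_mul_le_iff₀ hb', mul_one] at h2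
    exact h2

theorem isPos_onFiber {b : B.Fiber (1 : G)} (hb : IsPos b) : IsPos (E.onFiber b) :=
  isPos_map_of_contractive A.unitFiber (A.isClosed_fiber 1) (E.onFiberₗ 1) E.onFiber_mem
    (fun _ ha => E.onFiber_eq_self ha) E.norm_onFiber_unit_le
    (fun _ ha b _ hc => E.onFiber_fmul_fmul _ _ b ha hc) hb

variable {n : ℕ} (t : Fin n → G)

theorem onMat_eq_self {M : B.MatAlg t} (hM : M ∈ A.matAlg t) : (E.onMat t M : B.MatAlg t) = M :=
  FellBundle.MatAlg.ext fun i j => E.onFiber_eq_self (hM i j)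

theorem onMat_mul_left (N : A.matAlg t) (M : B.MatAlg t) :
    E.onMat t ((N : B.MatAlg t) * M) = N * E.onMat t M := by
  refine Subtype.ext (FellBundle.MatAlg.ext fun i j => ?_)
  change E.onFiber (((N : B.MatAlg t) * M) i j) = ((N : B.MatAlg t) * (E.onMat t M : B.MatAlg t)) i j
  rw [FellBundle.MatAlg.mul_apply, FellBundle.MatAlg.mul_apply, onFiber_sum]
  exact Finset.sum_congr rfl fun k _ => E.onFiber_fmul_left _ (N.2 i k) _

theorem onMat_mul_right (N : A.matAlg t) (M : B.MatAlg t) :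
    E.onMat t (M * (N : B.MatAlg t)) = E.onMat t M * N := by
  refine Subtype.ext (FellBundle.MatAlg.ext fun i j => ?_)
  change E.onFiber ((M * (N : B.MatAlg t)) i j) = ((E.onMat t M : B.MatAlg t) * (N : B.MatAlg t)) i j
  rw [FellBundle.MatAlg.mul_apply, FellBundle.MatAlg.mul_apply, onFiber_sum]
  exact Finset.sum_congr rfl fun k _ => E.onFiber_fmul_right _ _ (N.2 k j)

theorem diag_onMat (k : Fin n) (M : B.MatAlg t) :
    FellBundle.diag k (E.onMat t M : B.MatAlg t) = E.onFiber (FellBundle.diag k M) := rfl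

/-- The criterion is used relative to `𝕄_t(A)`: only then do the test matrices `Y` pass through
`E_t`. Since `E` commutes with taking diagonal entries, positivity of `E` on `B_e` finishes the
argument. -/
theorem isPos_onMat {M : B.MatAlg t} (hM : IsPos M) : IsPos (E.onMat t M) := by
  obtain ⟨C, rfl⟩ := hM
  refine FellBundle.exists_eq_star_mul_self_of_diag_conj_nonneg _ (A.isClosed_matAlg t) _
    fun Y hY k => ?_
  have h1 : (E.onMat t (star Y * (star C * C) * Y) : B.MatAlg t) =
      star Y * (E.onMat t (star C * C) : B.MatAlg t) * Y := by
    have := (E.onMat_mul_right t ⟨Y, hY⟩ (star Y * (star C * C))).trans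
      (congrArg (· * (⟨Y, hY⟩ : A.matAlg t)) (E.onMat_mul_left t (star ⟨Y, hY⟩) (star C * C)))
    exact congrArg Subtype.val this
  rw [← h1, diag_onMat, FellBundle.nonneg_iff_isPos]
  exact E.isPos_onFiber
    (FellBundle.nonneg_iff_isPos.mp (FellBundle.diag_conj_star_mul_self_nonneg k C Y))

end CondExpectation

theorem proposition2p6 {G : Type u} [Group G] [TopologicalSpace G] [IsTopologicalGroup G]
    [LocallyCompactSpace G] [T2Space G] (B : FellBundle.{u, v} G) (A : FellSubbundle B)
    (E : CondExpectation B A) {n : ℕ} (t : Fin n → G) :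
    -- `E_t` is idempotent
    (∀ M : B.MatAlg t, E.onMat t (E.onMat t M : B.MatAlg t) = E.onMat t M) ∧
    -- `E_t` is positive
    (∀ M : B.MatAlg t, IsPos M → IsPos (E.onMat t M)) ∧
    -- `E_t` is a bimodule map over `𝕄_t(A)`
    (∀ (N : A.matAlg t) (M : B.MatAlg t),
      E.onMat t ((N : B.MatAlg t) * M) = N * E.onMat t M ∧
      E.onMat t (M * (N : B.MatAlg t)) = E.onMat t M * N) ∧
    -- the image of `E_t` is `𝕄_t(A)`
    Set.range (fun M : B.MatAlg t => (E.onMat t M : B.MatAlg t)) =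
      (A.matAlg t : Set (B.MatAlg t)) ∧
    -- the positivity criterion
    (∀ M : B.MatAlg t, IsPos M ↔
      ∀ (k : Fin n) (y : B.Y fun i => t i * (t k)⁻¹), IsPos (B.quadForm t (t k)⁻¹ M y)) := by
  refine ⟨fun M => Subtype.ext (E.onMat_eq_self t (E.onMat t M).2), fun M => E.isPos_onMat t,
    fun N M => ⟨E.onMat_mul_left t N M, E.onMat_mul_right t N M⟩, ?_,
    FellBundle.isPos_iff_quadForm⟩
  refine Set.Subset.antisymm ?_ fun M hM => ⟨M, E.onMat_eq_self t hM⟩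
  rintro _ ⟨M, rfl⟩
  exact (E.onMat t M).2
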